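/- Let $A$ be a (partially) ordered alphabet, not necessarily finite, equipped with an order-preserving involution $a\mapsto\bar a$; extend it to words by $\overline{a_0\cdots a_{k-1}}=\overline{a_{k-1}}\cdots\overline{a_0}$ and to sets of words elementwise. Order $A^*$ by the Higman ordering: $a_0\cdots a_{k-1}\le b_0\cdots b_{l-1}$ iff there is a strictly increasing map $h$ from $\{0,\dots,k-1\}$ to $\{0,\dots,l-1\}$ with $a_i\le b_{h(i)}$ for all $i$. A final segment is a subset of $A^*$ closed upwards. A final segment $F$ is *irreducible* if $F\ne A^*$ and $F$ is not the concatenation $GH$ of two final segments $G,H$ both distinct from $F$. A *metric space over $\mathbf F(A^*)$* is a set $E$ with a map $d$ from $E\times E$ to the set of final segments such that $d(p,q)=A^*$ iff $p=q$; $d(p,r)\,d(r,q)\subseteq d(p,q)$; and $\overline{d(q,p)}=d(p,q)$. A map $f:E\to E'$ is *non-expansive* if $d(p,q)\subseteq d'(f(p),f(q))$ for all $p,q$, and an *isometry* if equality always holds. A space $E$ is *injective* if for every non-expansive $f:X\to E$ and every isometry $g:X\to Y$ there is a non-expansive $h:Y\to E$ with $h\circ g=f$. An *injective envelope* of the two-element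 space $\{x,y\}$ with $d(x,y)=F$ is an injective space containing it isometrically and having no proper injective subspace that contains $x$ and $y$. A space $S$ is the *gluing* of two subspaces $E_1,E_2$ by the vertex $c$ if $S=E_1\cup E_2$, $E_1\cap E_2=\{c\}$ and $d(p,q)=d(p,c)\,d(c,q)$ for $p\in E_1$, $q\in E_2$; an injective space is *irreducible* if it is not the gluing of two proper injective subspaces. The transition system $\mathcal M$ of a space has the points as states, and the transitions $(p,a,q)$ with $a\in A$ and $a\in d(p,q)$; the (undirected) graph $\mathcal G$ of the space links $p\neq q$ iff there is a transition $(p,a,q)$. A *cut vertex* of a graph is a vertex whose removal disconnects its connected component; a *block* is a maximal connected subgraph (identified with its vertex set) without a cut vertex. **Theorem** (Kabil–Pouzet–Rosenberg). Let $F$ be a final segment of $A^*$ with $F\ne A^*$. Then the two-element space $\{x,y\}$ with $d(x,y)=F$ has an injective envelope. Let $\mathcal S_F$ be any such envelope, $\mathcal M_F$ its transition system and $\mathcal G_F$ its graph. The automaton $\mathcal A_F=(\mathcal M_F,\{x\},\{y\})$, with initial state $x$ and final state $y$, accepts $F$, and the following are equivalent: $F$ is irreducible; $\mathcal S_F$ is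 irreducible; $\mathcal G_F$ has no cut vertex. If $F$ is not irreducible, then the blocks of $\mathcal G_F$ are the vertices of a finite path: for some $n\ge 2$ they can be listed without repetition as $C_0,\dots,C_{n-1}$ with $C_i\cap C_j=\emptyset$ whenever $|i-j|\ge 2$, with $C_i\cap C_{i+1}$ a singleton for $0\le i<n-1$, and with $x\in C_0$, $y\in C_{n-1}$. Put $x_0=x$, $y_{n-1}=y$ and $C_i\cap C_{i+1}=\{y_i\}=\{x_{i+1}\}$ for $0\le i<n-1$. Then there are final segments $F_0,\dots,F_{n-1}$ with $F=F_0F_1\cdots F_{n-1}$ such that, for every $i$, the automaton $(\mathcal M_F\restriction C_i,\{x_i\},\{y_i\})$ accepts $F_i$, and it is isomorphic to $\mathcal A_{F_i}$, that is, a two-element space $\{x',y'\}$ with $d(x',y')=F_i$ has an injective envelope, and the automaton $(\mathcal M_{F_i},\{x'\},\{y'\})$ of any such envelope is isomorphic to $(\mathcal M_F\restriction C_i,\{x_i\},\{y_i\})$. -/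

import Mathlib

universe u

namespace WordMetric

/-! ### Words, final segments, irreducibility -/

section Words

variable {A : Type u}

/-- The Higman ordering on words over an ordered alphabet: `v ≤ w` if some increasing injection of
the positions of `v` into the positions of `w` sends every letter to a larger or equal letter. -/
def Higman [PartialOrder A] (v w : List A) : Prop :=
  List.SublistForall₂ (· ≤ ·) v w

/-- A final segment of `A*` for the Higman ordering. -/
def IsFinalSegment [PartialOrder A] (F : Language A) : Prop :=
  ∀ v w : List A, Higman v w → v ∈ F → w ∈ F

/-- A final segment is irreducible if it is distinct from `A*` and is not the concatenation of two
final segments both distinct from it. -/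
def IsIrreducibleSegment [PartialOrder A] (F : Language A) : Prop :=
  IsFinalSegment F ∧ F ≠ ⊤ ∧
    ¬ ∃ G H : Language A, IsFinalSegment G ∧ IsFinalSegment H ∧ G ≠ F ∧ H ≠ F ∧ F = G * H

/-- The involution on words induced by `bar` on letters: bar every letter, reverse the word. -/
def barWord (bar : A → A) (w : List A) : List A := (w.map bar).reverse

/-- The induced involution on sets of words. -/
def barLang (bar : A → A) (L : Language A) : Language A := {w | ∃ v ∈ L, barWord bar v = w}

end Words

/-! ### Metric spaces over the final segments -/

/-- A metric on `E` with values in the final segments of `A*`. The value monoid is ordered by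
*reverse* inclusion, its operation is concatenation and its neutral and least element is `A*`. -/
structure FMetric {A : Type u} [PartialOrder A] (bar : A → A) (E : Type u) where
  d : E → E → Language A
  isFinalSegment : ∀ p q, IsFinalSegment (d p q)
  eq_top_iff : ∀ p q, d p q = ⊤ ↔ p = q
  triangle : ∀ p q r, d p r * d r q ≤ d p q
  symm : ∀ p q, barLang bar (d q p) = d p q

namespace FMetric

variable {A : Type u} [PartialOrder A] {bar : A → A} {E E' : Type u}

/-- Non-expansive maps (the order on values is reverse inclusion). -/
def NonExpansive (D : FMetric bar E) (D' : FMetric bar E') (f : E → E') : Prop :=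
  ∀ p q, D.d p q ≤ D'.d (f p) (f q)

def IsIsometry (D : FMetric bar E) (D' : FMetric bar E') (f : E → E') : Prop :=
  ∀ p q, D'.d (f p) (f q) = D.d p q

/-- The subspace induced on a set of points. -/
def restrict (D : FMetric bar E) (s : Set E) : FMetric bar s where
  d p q := D.d p q
  isFinalSegment p q := D.isFinalSegment p q
  eq_top_iff p q := (D.eq_top_iff p q).trans Subtype.ext_iff.symm
  triangle p q r := D.triangle p q r
  symm p q := D.symm p q

/-- Injectivity: non-expansive maps into the space extend along isometries. -/
def IsInjective (D : FMetric bar E) : Prop :=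
  ∀ (X Y : Type u) (DX : FMetric bar X) (DY : FMetric bar Y) (f : X → E) (g : X → Y),
    DX.NonExpansive D f → DX.IsIsometry DY g →
      ∃ h : Y → E, DY.NonExpansive D h ∧ h ∘ g = f

/-- `D` is an injective envelope of its subspace `{x, y}`, where `d(x, y) = F`: it is injective and
no proper subspace containing `x` and `y` is injective. -/
def IsInjectiveEnvelope (D : FMetric bar E) (x y : E) (F : Language A) : Prop :=
  D.d x y = F ∧ D.IsInjective ∧
    ∀ s : Set E, x ∈ s → y ∈ s → (D.restrict s).IsInjective → s = Set.univ

/-- `D` is the gluing of its subspaces `s` and `t` by the common point `c`. -/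
def IsGluing (D : FMetric bar E) (s t : Set E) (c : E) : Prop :=
  s ∪ t = Set.univ ∧ s ∩ t = {c} ∧ ∀ p ∈ s, ∀ q ∈ t, D.d p q = D.d p c * D.d c q

/-- An injective space which is not the gluing of two proper injective subspaces. -/
def IsIrreducible (D : FMetric bar E) : Prop :=
  D.IsInjective ∧
    ¬ ∃ (s t : Set E) (c : E), s ≠ Set.univ ∧ t ≠ Set.univ ∧
      (D.restrict s).IsInjective ∧ (D.restrict t).IsInjective ∧ D.IsGluing s t c

end FMetric

/-! ### Transition systems and automata -/

/-- A transition system on the alphabet `A` with set of states `Q`: a set of transitions. -/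
abbrev TransitionSystem (A Q : Type u) := Set (Q × A × Q)

namespace TransitionSystem

variable {A Q : Type u}

/-- The restriction of a transition system to a set of states. -/
def restrict (T : TransitionSystem A Q) (C : Set Q) : TransitionSystem A C :=
  {t | (t.1.1, t.2.1, t.2.2.1) ∈ T}

/-- The automaton `(T, {x}, {y})` with one initial state `x` and one final state `y`. -/
def automaton (T : TransitionSystem A Q) (x y : Q) : NFA A Q where
  step p a := {q | (p, a, q) ∈ T}
  start := {x}
  accept := {y}

end TransitionSystem

/-- Isomorphism of automata over the same alphabet. -/
def AutomataIso {A Q Q' : Type u} (M : NFA A Q) (N : NFA A Q') : Prop :=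
  ∃ e : Q ≃ Q', (∀ p a q, q ∈ M.step p a ↔ e q ∈ N.step (e p) a) ∧
    (∀ p, p ∈ M.start ↔ e p ∈ N.start) ∧ (∀ p, p ∈ M.accept ↔ e p ∈ N.accept)

namespace FMetric

variable {A : Type u} [PartialOrder A] {bar : A → A} {E : Type u}

/-- The transition system of a space: `(p, a, q)` is a transition if the one-letter word `a` belongs
to `d(p, q)`. -/
def transitionSystem (D : FMetric bar E) : TransitionSystem A E :=
  {t | [t.2.1] ∈ D.d t.1 t.2.2}

/-- The undirected graph of the transition system: distinct points are adjacent if some transition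
links them. (Loops, which play no role for cut vertices and blocks, are left out.) -/
def graph (D : FMetric bar E) : SimpleGraph E where
  Adj p q := p ≠ q ∧ ∃ a, (p, a, q) ∈ D.transitionSystem
  symm := ⟨by
    rintro p q ⟨hpq, a, ha⟩
    refine ⟨hpq.symm, bar a, ?_⟩
    have h : barWord bar [a] ∈ barLang bar (D.d p q) := ⟨[a], ha, rfl⟩
    rw [D.symm q p] at h
    exact h⟩
  loopless := ⟨fun _ h => h.1 rfl⟩

end FMetric

/-! ### Cut vertices and blocks -/

/-- `c` is a cut vertex if deleting it disconnects its connected component: two other vertices,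
joined by a path of the graph, are not joined by any path avoiding `c`. -/
def IsCutVertex {V : Type u} (G : SimpleGraph V) (c : V) : Prop :=
  ∃ v w : ({c}ᶜ : Set V), G.Reachable v w ∧ ¬ (G.induce {c}ᶜ).Reachable v w

/-- A block: (the vertex set of) a maximal connected subgraph which has no cut vertex. -/
def IsBlock {V : Type u} (G : SimpleGraph V) (B : Set V) : Prop :=
  Maximal (fun C : Set V => (G.induce C).Connected ∧ ¬ ∃ c, IsCutVertex (G.induce C) c) B

end WordMetric

/-! The points of the envelope are the left polars `leftPolar F W`, the sets of words `u` with `u W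
⊆ F`: `x` is `⊤`, `y` is `F`, and `d(x, P) = P`. `IsTight` axiomatizes this space. It is rigid: a
non-expansive self-map fixing `x` and `y` can only enlarge `d(x, p)` and `d(p, y)`, whereas
enlarging `d(p, y)` shrinks its polar `d(x, p)`. Rigidity gives minimality and forces every
injective envelope to be tight (`IsInjectiveEnvelope.isTight`), so everything else is proved for
tight spaces. There words can be cut at intermediate points (`exists_between`), hence the words of
`d(p, q)` are those read from `p` to `q`.

The equivalences compare three ways of cutting. A factorization `F = G H` with `F` nonempty yields a
point `c` with `d(x, c) = G` and `d(c, y) = H` at which the space is glued (`exists_isGluing`,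
resting on `IsFinalSegment.exists_split`). No edge crosses a gluing away from `c`, so a proper
factorization gives a cut vertex. Conversely, words between points separated by a cut vertex must be
read through it, so the space is glued there; and by minimality a gluing of two proper injective
parts separates `x` from `y` and factors `F`.

If `F` is reducible, it is a product of irreducible segments, and the partial products give
successive gluing points. The pieces between them inherit rigidity (`restrict_inter`) and are tight
for the factors, hence connected without cut vertex. A connected set without cut vertex cannot
straddle a gluing, so these pieces are exactly the blocks. -/

namespace WordMetric

/-! ### Concatenation, cancellation and factorization of final segments -/

section Words

variable {A : Type u}

theorem barWord_involutive {bar : A → A} (hb : Function.Involutive bar) :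
    Function.Involutive (barWord bar) := fun w => by
  simp [barWord, List.map_reverse, hb.comp_self]

theorem barWord_append (bar : A → A) (v w : List A) :
    barWord bar (v ++ w) = barWord bar w ++ barWord bar v := by
  simp [barWord]

theorem mem_barLang {bar : A → A} (hb : Function.Involutive bar) {L : Language A} {w : List A} :
    w ∈ barLang bar L ↔ barWord bar w ∈ L := by
  constructor
  · rintro ⟨v, hv, rfl⟩
    rwa [barWord_involutive hb]
  · intro h
    exact ⟨_, h, barWord_involutive hb w⟩

theorem mem_top (w : List A) : w ∈ (⊤ : Language A) := Set.mem_univ w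

theorem exists_mem_of_exists_mem_mul {G H : Language A} {w : List A} (h : w ∈ G * H) :
    (∃ g, g ∈ G) ∧ ∃ k, k ∈ H := by
  obtain ⟨g, hg, k, hk, -⟩ := Language.mem_mul.1 h
  exact ⟨⟨g, hg⟩, k, hk⟩

variable [PartialOrder A] {F G H : Language A}

theorem Higman.of_sublist {v w : List A} (h : v.Sublist w) : Higman v w :=
  h.sublistForall₂

theorem Higman.refl (v : List A) : Higman v v := Higman.of_sublist (List.Sublist.refl v)

theorem Higman.append {v w v' w' : List A} (h : Higman v w) (h' : Higman v' w') :
    Higman (v ++ v') (w ++ w') := by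
  obtain ⟨l, hl, hs⟩ := List.sublistForall₂_iff.1 h
  obtain ⟨l', hl', hs'⟩ := List.sublistForall₂_iff.1 h'
  exact List.sublistForall₂_iff.2 ⟨l ++ l', List.rel_append hl hl', hs.append hs'⟩

theorem Higman.barWord {bar : A → A} (hm : Monotone bar) {v w : List A} (h : Higman v w) :
    Higman (barWord bar v) (barWord bar w) := by
  obtain ⟨l, hl, hs⟩ := List.sublistForall₂_iff.1 h
  refine List.sublistForall₂_iff.2 ⟨WordMetric.barWord bar l, ?_, (hs.map bar).reverse⟩
  refine List.rel_reverse ?_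
  simp only [List.forall₂_map_left_iff, List.forall₂_map_right_iff]
  exact hl.imp fun _ _ hab => hm hab

theorem Higman.exists_append {g h w : List A} (hw : Higman (g ++ h) w) :
    ∃ g' h', Higman g g' ∧ Higman h h' ∧ g' ++ h' = w := by
  obtain ⟨l, hl, hs⟩ := List.sublistForall₂_iff.1 hw
  have h₁ := List.forall₂_take_append l.reverse.reverse g h (by simpa using hl.flip)
  have h₂ := List.forall₂_drop_append l.reverse.reverse g h (by simpa using hl.flip)
  rw [List.reverse_reverse] at h₁ h₂
  rw [← List.take_append_drop g.length l] at hs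
  obtain ⟨r₁, r₂, rfl, hr₁, hr₂⟩ := List.append_sublist_iff.1 hs
  exact ⟨r₁, r₂, List.sublistForall₂_iff.2 ⟨_, h₁.flip, hr₁⟩,
    List.sublistForall₂_iff.2 ⟨_, h₂.flip, hr₂⟩, rfl⟩

namespace IsFinalSegment

theorem of_sublist (hF : IsFinalSegment F) {v w : List A} (h : v.Sublist w) (hv : v ∈ F) : w ∈ F :=
  hF v w (Higman.of_sublist h) hv

theorem append_left (hF : IsFinalSegment F) (u : List A) {v : List A} (hv : v ∈ F) : u ++ v ∈ F :=
  hF.of_sublist (List.sublist_append_right u v) hv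

theorem append_right (hF : IsFinalSegment F) {u : List A} (v : List A) (hu : u ∈ F) : u ++ v ∈ F :=
  hF.of_sublist (List.sublist_append_left u v) hu

theorem eq_top_iff_nil_mem (hF : IsFinalSegment F) : F = ⊤ ↔ [] ∈ F := by
  constructor
  · rintro rfl
    exact mem_top _
  · intro h
    ext w
    exact ⟨fun _ => mem_top w, fun _ => hF.of_sublist (List.nil_sublist w) h⟩

theorem top : IsFinalSegment (⊤ : Language A) := fun _ w _ _ => mem_top w

theorem mul (hG : IsFinalSegment G) (hH : IsFinalSegment H) : IsFinalSegment (G * H) := by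
  intro v w hvw hv
  obtain ⟨g, hg, h, hh, rfl⟩ := Language.mem_mul.1 hv
  obtain ⟨g', h', hgg, hhh, rfl⟩ := hvw.exists_append
  exact Language.append_mem_mul (hG _ _ hgg hg) (hH _ _ hhh hh)

theorem mul_le_left (hG : IsFinalSegment G) : G * H ≤ G := by
  intro w hw
  obtain ⟨g, hg, h, -, rfl⟩ := Language.mem_mul.1 hw
  exact hG.append_right h hg

theorem mul_le_right (hH : IsFinalSegment H) : G * H ≤ H := by
  intro w hw
  obtain ⟨g, -, h, hh, rfl⟩ := Language.mem_mul.1 hw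
  exact hH.append_left g hh

theorem top_mul (hF : IsFinalSegment F) : ⊤ * F = F :=
  le_antisymm hF.mul_le_right fun w hw =>
    Language.mem_mul.2 ⟨[], mem_top _, w, hw, rfl⟩

theorem mul_top (hF : IsFinalSegment F) : F * ⊤ = F :=
  le_antisymm hF.mul_le_left fun w hw =>
    Language.mem_mul.2 ⟨w, hw, [], mem_top _, List.append_nil w⟩

/-- The cut between the two factors falls before or after the letter `a`, so one of the two sides
survives the loss of `a`. This gain of one letter drives `exists_split`. -/
theorem mem_or_mem_of_append_cons (hG : IsFinalSegment G) (hH : IsFinalSegment H)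
    {u v : List A} {a : A} (h : u ++ a :: v ∈ G * H) : u ∈ G ∨ v ∈ H := by
  obtain ⟨g, hg, k, hk, he⟩ := Language.mem_mul.1 h
  rcases List.append_eq_append_iff.1 he with ⟨l, rfl, -⟩ | ⟨l, rfl, h'⟩
  · exact Or.inl (hG.append_right l hg)
  · cases l with
    | nil => exact Or.inl (by simpa using hg)
    | cons b l =>
      obtain ⟨-, rfl⟩ := List.cons_eq_cons.1 h'
      exact Or.inr (hH.append_left l hk)

theorem mem_or_mem_of_append (hG : IsFinalSegment G) (hH : IsFinalSegment H)
    {u v : List A} (h : u ++ v ∈ G * H) : u ∈ G ∨ v ∈ H := by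
  obtain ⟨g, hg, k, hk, he⟩ := Language.mem_mul.1 h
  rcases List.append_eq_append_iff.1 he with ⟨l, rfl, -⟩ | ⟨l, rfl, rfl⟩
  · exact Or.inl (hG.append_right l hg)
  · exact Or.inr (hH.append_left l hk)

/-- Left cancellation for final segments. -/
theorem mem_of_forall_append_mem_mul_left (hH : IsFinalSegment H) (hG : ∃ g, g ∈ G) {w : List A}
    (h : ∀ g ∈ G, g ++ w ∈ G * H) : w ∈ H := by
  -- For a shortest word `g` of `G`, the `G`-part of any splitting of `g ++ w` is at least as long
  -- as `g`, so the cut falls inside `w`.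
  obtain ⟨g, hg, hmin⟩ := (measure (List.length (α := A))).wf.has_min {g | g ∈ G} hG
  obtain ⟨g', hg', k, hk, he⟩ := Language.mem_mul.1 (h g hg)
  have hle : g.length ≤ g'.length := not_lt.1 (hmin g' hg')
  have hw : w = (g' ++ k).drop g.length := by rw [he]; simp
  rw [hw, List.drop_append]
  have : k.drop (g.length - g'.length) = k := by
    rw [Nat.sub_eq_zero_of_le hle, List.drop_zero]
  rw [this]
  exact hH.append_left _ hk

/-- Right cancellation for final segments. -/
theorem mem_of_forall_append_mem_mul_right (hG : IsFinalSegment G) (hH : ∃ h, h ∈ H) {w : List A}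
    (h : ∀ k ∈ H, w ++ k ∈ G * H) : w ∈ G := by
  obtain ⟨k, hk, hmin⟩ := (measure (List.length (α := A))).wf.has_min {k | k ∈ H} hH
  obtain ⟨g, hg, k', hk', he⟩ := Language.mem_mul.1 (h k hk)
  have hle : k.length ≤ k'.length := not_lt.1 (hmin k' hk')
  rcases List.append_eq_append_iff.1 he with ⟨l, rfl, -⟩ | ⟨l, rfl, rfl⟩
  · exact hG.append_right l hg
  · have : l = [] := by simpa using hle
    subst this
    simpa using hg

theorem mul_left_cancel (hH : IsFinalSegment H) {K : Language A} (hK : IsFinalSegment K)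
    (hG : ∃ g, g ∈ G) (h : G * K = G * H) : K = H := by
  refine le_antisymm (fun w hw => ?_) (fun w hw => ?_)
  · exact hH.mem_of_forall_append_mem_mul_left hG fun g hg => h ▸ Language.append_mem_mul hg hw
  · exact hK.mem_of_forall_append_mem_mul_left hG fun g hg => h ▸ Language.append_mem_mul hg hw

/-- If `P w Q ⊆ G H` with `P ⊈ G` and `H ⊆ Q`, then `w = r t` with `P r ⊆ G` and `t Q ⊆ H`. -/
theorem exists_split (hG : IsFinalSegment G) (hH : IsFinalSegment H) (hHne : ∃ h, h ∈ H)
    {Q : Language A} (hHQ : H ≤ Q) (w : List A) {P : Language A} (hP : ¬ P ≤ G)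
    (h : ∀ u ∈ P, ∀ v ∈ Q, u ++ w ++ v ∈ G * H) :
    ∃ r t, r ++ t = w ∧ (∀ u ∈ P, u ++ r ∈ G) ∧ ∀ v ∈ Q, t ++ v ∈ H := by
  induction w generalizing P with
  | nil =>
    -- With nothing left to split, `P H ⊆ G H`, and right cancellation contradicts `P ⊈ G`.
    exact absurd (fun u hu => hG.mem_of_forall_append_mem_mul_right hHne fun k hk => by
      simpa using h u hu k (hHQ hk)) hP
  | cons a w ih =>
    obtain ⟨u₀, hu₀, hu₀G⟩ : ∃ u ∈ P, u ∉ G := by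
      by_contra! hc
      exact hP fun u hu => hc u hu
    -- Cut `w` just after the first letter that brings all of `P` into `G`. Before that letter some
    -- `u₀` is still outside `G`, which forces the remainder into `H` for every `v`; this makes the
    -- cut uniform in `u` and `v`.
    by_cases hPa : ∀ u ∈ P, u ++ [a] ∈ G
    · refine ⟨[a], w, rfl, hPa, fun v hv => ?_⟩
      have := h u₀ hu₀ v hv
      rw [List.append_assoc, List.cons_append] at this
      exact (hG.mem_or_mem_of_append_cons hH this).resolve_left hu₀G
    · push Not at hPa
      obtain ⟨u₁, hu₁, hu₁G⟩ := hPa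
      obtain ⟨r, t, rfl, hr, ht⟩ := ih (P := ({v | ∃ u ∈ P, v = u ++ [a]} : Set (List A)))
        (fun hle => hu₁G (hle ⟨u₁, hu₁, rfl⟩))
        (by rintro _ ⟨u, hu, rfl⟩ v hv; simpa using h u hu v hv)
      refine ⟨a :: r, t, rfl, fun u hu => ?_, ht⟩
      simpa using hr _ ⟨u, hu, rfl⟩

end IsFinalSegment

/-- A factorization witnessing that a nonempty final segment is not irreducible. -/
theorem exists_mul_eq_of_not_irreducible (hF : IsFinalSegment F) (hne : F ≠ ⊤)
    (h : ¬ IsIrreducibleSegment F) :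
    ∃ G H : Language A, IsFinalSegment G ∧ IsFinalSegment H ∧ G ≠ F ∧ H ≠ F ∧ G ≠ ⊤ ∧ H ≠ ⊤ ∧
      F = G * H := by
  have h' : ∃ G H : Language A, IsFinalSegment G ∧ IsFinalSegment H ∧ G ≠ F ∧ H ≠ F ∧ F = G * H := by
    by_contra hc
    exact h ⟨hF, hne, hc⟩
  obtain ⟨G, H, hG, hH, hGF, hHF, rfl⟩ := h'
  refine ⟨G, H, hG, hH, hGF, hHF, ?_, ?_, rfl⟩
  · rintro rfl
    exact hHF hH.top_mul.symm
  · rintro rfl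
    exact hGF hG.mul_top.symm

/-- The empty segment is irreducible, since a product of nonempty languages is nonempty. -/
theorem exists_mem_of_not_irreducible (hF : IsFinalSegment F) (hne : F ≠ ⊤)
    (h : ¬ IsIrreducibleSegment F) : ∃ w, w ∈ F := by
  obtain ⟨G, H, -, -, hGF, hHF, -, -, he⟩ := exists_mul_eq_of_not_irreducible hF hne h
  by_contra! hc
  obtain ⟨g, hg⟩ : ∃ g, g ∈ G := by
    by_contra! hG
    exact hGF (Language.ext fun w => iff_of_false (hG w) (hc w))
  obtain ⟨k, hk⟩ : ∃ k, k ∈ H := by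
    by_contra! hH
    exact hHF (Language.ext fun w => iff_of_false (hH w) (hc w))
  exact hc (g ++ k) (he ▸ Language.append_mem_mul hg hk)

/-- Every nonempty final segment distinct from `A*` is a product of irreducible ones. -/
theorem exists_irreducible_factorization (w : List A) (hF : IsFinalSegment F) (hne : F ≠ ⊤)
    (hw : w ∈ F) : ∃ L : List (Language A), L ≠ [] ∧ (∀ G ∈ L, IsIrreducibleSegment G) ∧
      L.prod = F := by
  -- Proper factors do not contain the empty word, so each factor contains a strictly shorter word.
  induction hn : w.length using Nat.strong_induction_on generalizing w F with
  | _ n ih =>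
    by_cases hirr : IsIrreducibleSegment F
    · exact ⟨[F], by simp, by simpa using hirr, by simp⟩
    obtain ⟨G, H, hG, hH, -, -, hGt, hHt, rfl⟩ := exists_mul_eq_of_not_irreducible hF hne hirr
    obtain ⟨g, hg, k, hk, rfl⟩ := Language.mem_mul.1 hw
    have hg0 : 0 < g.length := List.length_pos_iff.2 fun h0 =>
      hGt (hG.eq_top_iff_nil_mem.2 (h0 ▸ hg))
    have hk0 : 0 < k.length := List.length_pos_iff.2 fun h0 =>
      hHt (hH.eq_top_iff_nil_mem.2 (h0 ▸ hk))
    rw [List.length_append] at hn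
    obtain ⟨L, hL, hLi, rfl⟩ := ih _ (by omega) g hG hGt hg rfl
    obtain ⟨M, hM, hMi, rfl⟩ := ih _ (by omega) k hH hHt hk rfl
    refine ⟨L ++ M, by simp [hL], fun K hK => ?_, by simp⟩
    exact (List.mem_append.1 hK).elim (hLi K) (hMi K)

end Words

end WordMetric

/-! ### Left polars and the injective envelope of two points -/

namespace WordMetric

/-- The left polar of a set of words `W` with respect to `F`. -/
def leftPolar {A : Type u} (F W : Language A) : Language A :=
  ({u | ∀ w ∈ W, u ++ w ∈ F} : Set (List A))

section LeftPolar

variable {A : Type u} {F : Language A}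

theorem leftPolar_anti {V W : Language A} (h : V ≤ W) : leftPolar F W ≤ leftPolar F V :=
  fun _ hu w hw => hu w (h hw)

variable [PartialOrder A]

theorem IsFinalSegment.leftPolar (hF : IsFinalSegment F) (W : Language A) :
    IsFinalSegment (leftPolar F W) :=
  fun _ _ h hv x hx => hF _ _ (h.append (Higman.refl x)) (hv x hx)

theorem IsFinalSegment.le_leftPolar (hF : IsFinalSegment F) (W : Language A) :
    F ≤ WordMetric.leftPolar F W :=
  fun _ hu x _ => hF.append_right x hu

theorem IsFinalSegment.leftPolar_self (hF : IsFinalSegment F) :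
    WordMetric.leftPolar F F = ⊤ := by
  ext w
  exact ⟨fun _ => mem_top w, fun _ _ hx => hF.append_left w hx⟩

theorem IsFinalSegment.leftPolar_top (hF : IsFinalSegment F) :
    WordMetric.leftPolar F ⊤ = F := by
  refine le_antisymm (fun w hw => ?_) (hF.le_leftPolar ⊤)
  have := hw [] (mem_top _)
  rwa [List.append_nil] at this

end LeftPolar

namespace FMetric

variable {A : Type u} [PartialOrder A] {bar : A → A} {E E' : Type u}

section Basic

variable (D : FMetric bar E) (D' : FMetric bar E')

theorem nil_mem_iff {p q : E} : [] ∈ D.d p q ↔ p = q := by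
  rw [← D.eq_top_iff, (D.isFinalSegment p q).eq_top_iff_nil_mem]

theorem d_self (p : E) : D.d p p = ⊤ := (D.eq_top_iff p p).2 rfl

theorem mem_d_self (p : E) (w : List A) : w ∈ D.d p p := D.d_self p ▸ mem_top w

theorem append_mem {p q r : E} {u v : List A} (hu : u ∈ D.d p r) (hv : v ∈ D.d r q) :
    u ++ v ∈ D.d p q :=
  D.triangle p q r (Language.append_mem_mul hu hv)

theorem barWord_mem {p q : E} {w : List A} (h : w ∈ D.d p q) : barWord bar w ∈ D.d q p := by
  rw [← D.symm q p]
  exact ⟨w, h, rfl⟩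

variable {D D'}

/-- Checking non-expansiveness on one of the pairs `(p, q)`, `(q, p)` suffices. -/
theorem d_le_of_d_le_symm {p q : E} {p' q' : E'} (h : D.d p q ≤ D'.d p' q') :
    D.d q p ≤ D'.d q' p' := by
  intro w hw
  rw [← D.symm q p] at hw
  obtain ⟨v, hv, rfl⟩ := hw
  exact D'.barWord_mem (h hv)

theorem NonExpansive.comp {E'' : Type u} {D'' : FMetric bar E''} {f : E → E'} {g : E' → E''}
    (hg : D'.NonExpansive D'' g) (hf : D.NonExpansive D' f) : D.NonExpansive D'' (g ∘ f) :=
  fun p q => (hf p q).trans (hg _ _)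

/-- The range of an idempotent non-expansive map of an injective space is injective. -/
theorem IsInjective.restrict_of_retraction (h : D.IsInjective) {s : Set E} {r : E → E}
    (hr : D.NonExpansive D r) (hrs : ∀ p, r p ∈ s) (hid : ∀ p ∈ s, r p = p) :
    (D.restrict s).IsInjective := by
  intro X Y DX DY f g hf hg
  obtain ⟨k, hk, hkg⟩ := h X Y DX DY (fun x => (f x : E)) g hf hg
  refine ⟨fun y => ⟨r (k y), hrs _⟩, hr.comp hk, ?_⟩
  funext x
  have : k (g x) = f x := congrFun hkg x
  exact Subtype.ext (by simp only [Function.comp]; rw [this, hid _ (f x).2])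

/-- An injective subspace is the range of a non-expansive retraction. -/
theorem IsInjective.exists_retraction {s : Set E} (h : (D.restrict s).IsInjective) :
    ∃ r : E → E, D.NonExpansive D r ∧ (∀ p, r p ∈ s) ∧ ∀ p ∈ s, r p = p := by
  obtain ⟨k, hk, hks⟩ := h s E (D.restrict s) D id Subtype.val (fun _ _ => le_rfl) fun _ _ => rfl
  exact ⟨fun p => k p, hk, fun p => (k p).2,
    fun p hp => congrArg Subtype.val (congrFun hks ⟨p, hp⟩)⟩

/-- An injective space in which the identity is the only non-expansive self-map fixing `x` and `y`
is an injective envelope. -/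
theorem IsInjective.isInjectiveEnvelope (h : D.IsInjective) {x y : E}
    (hr : ∀ f : E → E, D.NonExpansive D f → f x = x → f y = y → ∀ p, f p = p) :
    D.IsInjectiveEnvelope x y (D.d x y) := by
  refine ⟨rfl, h, fun s hx hy hs => ?_⟩
  obtain ⟨r, hr', hrs, hid⟩ := hs.exists_retraction
  refine Set.eq_univ_of_forall fun p => ?_
  rw [← hr r hr' (hid x hx) (hid y hy) p]
  exact hrs p

end Basic

/-- The description of the injective envelope of a two-element space: every point is determined by
its distance from `x`, these distances are the left polars for `F`, and the distances between
points are as small as possible. -/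
structure IsTight (D : FMetric bar E) (x y : E) (F : Language A) : Prop where
  d_eq : D.d x y = F
  inj : ∀ p q, D.d x p = D.d x q → p = q
  surj : ∀ W : Language A, ∃ p, D.d x p = leftPolar F W
  leftPolar_d : ∀ p, leftPolar F (D.d p y) = D.d x p
  mem_d : ∀ p q w, (∀ u ∈ D.d x p, u ++ w ∈ D.d x q) →
    (∀ u ∈ D.d x q, u ++ barWord bar w ∈ D.d x p) → w ∈ D.d p q

/-- The space of left polars for `F`. -/
def polarSpace (hb : Function.Involutive bar) (hm : Monotone bar) {F : Language A}
    (hF : IsFinalSegment F) : FMetric bar (Set.range (leftPolar F)) where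
  d P Q := ({w | (∀ u ∈ P.1, u ++ w ∈ Q.1) ∧ ∀ u ∈ Q.1, u ++ barWord bar w ∈ P.1} : Set (List A))
  isFinalSegment := by
    rintro ⟨_, V, rfl⟩ ⟨_, W, rfl⟩ v w hvw ⟨h₁, h₂⟩
    exact ⟨fun u hu => hF.leftPolar W _ _ ((Higman.refl u).append hvw) (h₁ u hu),
      fun u hu => hF.leftPolar V _ _ ((Higman.refl u).append (hvw.barWord hm)) (h₂ u hu)⟩
  eq_top_iff := by
    rintro ⟨_, V, rfl⟩ ⟨_, W, rfl⟩
    constructor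
    · intro h
      obtain ⟨h₁, h₂⟩ := (h.symm ▸ mem_top [] : [] ∈ _)
      refine Subtype.ext (Language.ext fun w => ⟨fun hw => ?_, fun hw => ?_⟩)
      · simpa using h₁ w hw
      · simpa [barWord] using h₂ w hw
    · intro h
      rw [← Subtype.ext_iff.1 h]
      exact Language.ext fun w => ⟨fun _ => mem_top w, fun _ =>
        ⟨fun u hu => (hF.leftPolar V).append_right w hu,
          fun u hu => (hF.leftPolar V).append_right _ hu⟩⟩
  triangle P Q R w hw := by
    obtain ⟨u, ⟨hu₁, hu₂⟩, v, ⟨hv₁, hv₂⟩, rfl⟩ := Language.mem_mul.1 hw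
    refine ⟨fun t ht => ?_, fun t ht => ?_⟩
    · simpa using hv₁ _ (hu₁ t ht)
    · simpa [barWord_append] using hu₂ _ (hv₂ t ht)
  symm P Q := by
    ext w
    refine (mem_barLang hb).trans ?_
    constructor
    · rintro ⟨h₁, h₂⟩
      exact ⟨fun u hu => by simpa [barWord_involutive hb w] using h₂ u hu, h₁⟩
    · rintro ⟨h₁, h₂⟩
      exact ⟨h₂, fun u hu => by simpa [barWord_involutive hb w] using h₁ u hu⟩

theorem exists_isTight (hb : Function.Involutive bar) (hm : Monotone bar) {F : Language A}
    (hF : IsFinalSegment F) : ∃ (S : Type u) (D : FMetric bar S) (x y : S), D.IsTight x y F := by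
  -- The test word `u = []` in `⊤` shows that the distance from `⊤` to a polar is that polar.
  have hx : ∀ P : Set.range (leftPolar F),
      (polarSpace hb hm hF).d ⟨⊤, F, hF.leftPolar_self⟩ P = P.1 := by
    rintro ⟨_, V, rfl⟩
    ext w
    exact ⟨fun h => h.1 [] (mem_top _), fun h =>
      ⟨fun u _ => (hF.leftPolar V).append_left u h, fun u _ => mem_top _⟩⟩
  refine ⟨_, polarSpace hb hm hF, ⟨⊤, F, hF.leftPolar_self⟩, ⟨F, ⊤, hF.leftPolar_top⟩,
    hx _, ?_, ?_, ?_, ?_⟩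
  · intro p q h
    rw [hx, hx] at h
    exact Subtype.ext h
  · exact fun W => ⟨⟨_, W, rfl⟩, hx _⟩
  · intro P
    rw [hx]
    obtain ⟨_, V, rfl⟩ := P
    refine le_antisymm (leftPolar_anti fun w hw => ?_) fun u hu w hw => hw.1 u hu
    exact ⟨fun u hu => hu w hw, fun u hu =>
      hF.le_leftPolar V (hF.append_right _ hu)⟩
  · intro p q w h₁ h₂
    rw [hx, hx] at h₁ h₂
    exact ⟨h₁, h₂⟩

namespace IsTight

variable {D : FMetric bar E} {x y : E} {F : Language A}

theorem isFinalSegment (h : D.IsTight x y F) : IsFinalSegment F := h.d_eq ▸ D.isFinalSegment x y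

theorem append_mem (h : D.IsTight x y F) {p : E} {u w : List A} (hu : u ∈ D.d x p)
    (hw : w ∈ D.d p y) : u ++ w ∈ F := h.d_eq ▸ D.append_mem hu hw

theorem mem_of_forall (h : D.IsTight x y F) {p : E} {u : List A}
    (hu : ∀ w ∈ D.d p y, u ++ w ∈ F) : u ∈ D.d x p := h.leftPolar_d p ▸ hu

theorem le_d (h : D.IsTight x y F) (p : E) : F ≤ D.d x p :=
  h.leftPolar_d p ▸ h.isFinalSegment.le_leftPolar _

/-- Thus `d(p, y)` is the full right polar of `d(x, p)`: the backward condition of `mem_d` is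
automatic because `F ⊆ d(x, p)`. -/
theorem mem_d_right (h : D.IsTight x y F) {p : E} {w : List A}
    (hw : ∀ u ∈ D.d x p, u ++ w ∈ F) : w ∈ D.d p y := by
  refine h.mem_d p y w (by rwa [h.d_eq]) fun u hu => ?_
  rw [h.d_eq] at hu
  exact h.le_d p (h.isFinalSegment.append_right _ hu)

theorem inj_right (h : D.IsTight x y F) {p q : E} (hpq : D.d p y = D.d q y) : p = q :=
  h.inj p q (by rw [← h.leftPolar_d, ← h.leftPolar_d, hpq])

/-- Polarity reverses inclusion, so both distances cannot grow together. This is the source of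
rigidity. -/
theorem eq_of_le (h : D.IsTight x y F) {p q : E} (h₁ : D.d x p ≤ D.d x q)
    (h₂ : D.d p y ≤ D.d q y) : p = q := by
  refine h.inj p q (le_antisymm h₁ ?_)
  rw [← h.leftPolar_d, ← h.leftPolar_d]
  exact leftPolar_anti h₂

theorem isInjective (h : D.IsTight x y F) : D.IsInjective := by
  intro X Y DX DY f g hf hg
  -- `W z` collects the words forced into `d(k z, y)`: from `z` to some `g a`, then from `f a` to
  -- `y`. Over `g a` itself nothing beyond `d(f a, y)` is forced, because `f` is non-expansive.
  let W : Y → Language A := fun z =>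
    ({w | ∃ a, ∃ u ∈ DY.d z (g a), ∃ v ∈ D.d (f a) y, w = u ++ v} : Set (List A))
  have hW : ∀ {z z' w v}, w ∈ DY.d z z' → v ∈ W z' → w ++ v ∈ W z := by
    rintro z z' w _ hw ⟨a, u, hu, v, hv, rfl⟩
    exact ⟨a, w ++ u, DY.append_mem hw hu, v, hv, (List.append_assoc _ _ _).symm⟩
  choose k hk using fun z => h.surj (W z)
  have hle : ∀ {z z' w}, w ∈ DY.d z z' → ∀ u ∈ D.d x (k z), u ++ w ∈ D.d x (k z') := by
    intro z z' w hw u hu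
    rw [hk] at hu ⊢
    intro v hv
    rw [List.append_assoc]
    exact hu _ (hW hw hv)
  refine ⟨k, fun z z' w hw => h.mem_d _ _ _ (hle hw) (hle (DY.barWord_mem hw)), ?_⟩
  funext a
  refine h.inj _ _ ?_
  rw [Function.comp, hk, ← h.leftPolar_d]
  congr 1
  refine le_antisymm ?_ fun v hv => ⟨a, [], DY.mem_d_self _ _, v, hv, rfl⟩
  rintro _ ⟨b, u, hu, v, hv, rfl⟩
  rw [hg] at hu
  exact D.append_mem (hf _ _ hu) hv

theorem eq_of_nonExpansive (h : D.IsTight x y F) (f : E → E) (hf : D.NonExpansive D f)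
    (hx : f x = x) (hy : f y = y) (p : E) : f p = p := by
  refine (h.eq_of_le ?_ ?_).symm
  · simpa only [hx] using hf x p
  · simpa only [hy] using hf p y

theorem isInjectiveEnvelope (h : D.IsTight x y F) : D.IsInjectiveEnvelope x y F := by
  have := h.isInjective.isInjectiveEnvelope h.eq_of_nonExpansive
  rwa [h.d_eq] at this

/-- Convexity: words in a distance can be split at intermediate points. -/
theorem exists_between (h : D.IsTight x y F) {p q : E} {u v : List A} (huv : u ++ v ∈ D.d p q) :
    ∃ r, u ∈ D.d p r ∧ v ∈ D.d r q := by
  have huv' := D.barWord_mem huv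
  rw [barWord_append] at huv'
  -- The words required from `r` to `y` are those through `q`, after `v`, and those through `p`,
  -- after the reversal of `u`.
  obtain ⟨r, hr⟩ := h.surj ({w | (∃ t ∈ D.d q y, w = v ++ t) ∨
    ∃ t ∈ D.d p y, w = barWord bar u ++ t} : Set (List A))
  refine ⟨r, h.mem_d _ _ _ (fun t ht => ?_) (fun t ht => ?_),
    h.mem_d _ _ _ (fun t ht => ?_) (fun t ht => ?_)⟩
  · rw [hr]
    rintro _ (⟨s, hs, rfl⟩ | ⟨s, hs, rfl⟩)
    · rw [← List.append_assoc, List.append_assoc t]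
      exact h.append_mem (D.append_mem ht huv) hs
    · refine h.isFinalSegment.of_sublist ?_ (h.append_mem ht hs)
      simp
  · rw [hr] at ht
    refine h.mem_of_forall fun s hs => ?_
    rw [List.append_assoc]
    exact ht _ (Or.inr ⟨s, hs, rfl⟩)
  · rw [hr] at ht
    refine h.mem_of_forall fun s hs => ?_
    rw [List.append_assoc]
    exact ht _ (Or.inl ⟨s, hs, rfl⟩)
  · rw [hr]
    rintro _ (⟨s, hs, rfl⟩ | ⟨s, hs, rfl⟩)
    · refine h.isFinalSegment.of_sublist ?_ (h.append_mem ht hs)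
      simp
    · rw [← List.append_assoc, List.append_assoc t]
      exact h.append_mem (D.append_mem ht huv') hs

theorem accepts_eq (h : D.IsTight x y F) (p q : E) :
    (D.transitionSystem.automaton p q).accepts = D.d p q := by
  have key : ∀ (w : List A) (p q : E),
      q ∈ (D.transitionSystem.automaton x y).evalFrom {p} w ↔ w ∈ D.d p q := by
    intro w
    induction w with
    | nil =>
      intro p q
      rw [D.nil_mem_iff, NFA.evalFrom_nil, Set.mem_singleton_iff, eq_comm]
    | cons a w ih =>
      intro p q
      rw [NFA.evalFrom_cons, NFA.stepSet_singleton, NFA.mem_evalFrom_iff_exists]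
      constructor
      · rintro ⟨r, hr, hq⟩
        exact D.append_mem (u := [a]) hr ((ih r q).1 hq)
      · intro hw
        obtain ⟨r, hr, hq⟩ := h.exists_between (u := [a]) hw
        exact ⟨r, hr, (ih r q).2 hq⟩
  ext w
  rw [← key w p q]
  constructor
  · rintro ⟨_, rfl, hq⟩
    exact hq
  · exact fun hq => ⟨q, rfl, hq⟩

/-- Two tight spaces for the same final segment are isometric. -/
theorem exists_isometry {D' : FMetric bar E'} {x' y' : E'} (h : D.IsTight x y F)
    (h' : D'.IsTight x' y' F) :
    ∃ e : E ≃ E', e x = x' ∧ e y = y' ∧ D.IsIsometry D' e := by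
  have key : ∀ {E₁ E₂ : Type u} {D₁ : FMetric bar E₁} {D₂ : FMetric bar E₂} {x₁ y₁ : E₁}
      {x₂ y₂ : E₂}, D₁.IsTight x₁ y₁ F → D₂.IsTight x₂ y₂ F →
      ∃ f : E₁ → E₂, ∀ p, D₂.d x₂ (f p) = D₁.d x₁ p := by
    intro E₁ E₂ D₁ D₂ x₁ y₁ x₂ y₂ h₁ h₂
    choose f hf using fun p => h₂.surj (D₁.d p y₁)
    exact ⟨f, fun p => by rw [hf, h₁.leftPolar_d]⟩
  obtain ⟨f, hf⟩ := key h h'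
  obtain ⟨g, hg⟩ := key h' h
  refine ⟨⟨f, g, fun p => h.inj _ _ (by rw [hg, hf]), fun p => h'.inj _ _ (by rw [hf, hg])⟩,
    h'.inj _ _ ?_, h'.inj _ _ ?_, fun p q => ?_⟩
  · exact (hf x).trans (by rw [D.d_self, D'.d_self])
  · exact (hf y).trans (by rw [h.d_eq, h'.d_eq])
  · refine le_antisymm (fun w hw => ?_) fun w hw => ?_
    · refine h.mem_d _ _ _ (fun u hu => ?_) fun u hu => ?_ <;> rw [← hf] at hu ⊢
      · exact D'.append_mem hu hw
      · exact D'.append_mem hu (D'.barWord_mem hw)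
    · refine h'.mem_d _ _ _ (fun u hu => ?_) fun u hu => ?_ <;>
        simp only [Equiv.coe_fn_mk, hf] at hu ⊢
      · exact D.append_mem hu hw
      · exact D.append_mem hu (D.barWord_mem hw)

theorem of_isometry {D' : FMetric bar E'} {x' y' : E'} (h : D.IsTight x y F) {f : E → E'}
    (hf : D.IsIsometry D' f) (hs : Function.Surjective f) (hx : f x = x') (hy : f y = y') :
    D'.IsTight x' y' F := by
  subst hx hy
  refine ⟨(hf _ _).trans h.d_eq, ?_, ?_, ?_, ?_⟩
  · rw [hs.forall₂]
    intro p q hpq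
    rw [hf, hf] at hpq
    rw [h.inj _ _ hpq]
  · intro W
    obtain ⟨p, hp⟩ := h.surj W
    exact ⟨f p, (hf _ _).trans hp⟩
  · rw [hs.forall]
    intro p
    rw [hf, hf, h.leftPolar_d]
  · rw [hs.forall₂]
    intro p q w
    rw [hf, hf, hf]
    exact h.mem_d p q w

end IsTight

/-- Polars map `D` to the tight space `N`, and injectivity of `D` gives a map back. By rigidity the
composite on `N` is the identity, so `N` embeds isometrically as a retract of `D`, and minimality
makes the embedding onto. -/
theorem IsInjectiveEnvelope.isTight (hb : Function.Involutive bar) (hm : Monotone bar)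
    {D : FMetric bar E} {x y : E} {F : Language A} (h : D.IsInjectiveEnvelope x y F) :
    D.IsTight x y F := by
  classical
  obtain ⟨hd, hinj, hmin⟩ := h
  have hF : IsFinalSegment F := hd ▸ D.isFinalSegment x y
  obtain ⟨N, DN, a, b, hN⟩ := exists_isTight hb hm hF
  choose k hk using fun p => hN.surj (D.d p y)
  have hle : ∀ {p q w}, w ∈ D.d p q → ∀ u ∈ DN.d a (k p), u ++ w ∈ DN.d a (k q) := by
    intro p q w hw u hu
    rw [hk] at hu ⊢
    intro v hv
    rw [List.append_assoc]
    exact hu _ (D.append_mem hw hv)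
  have hkne : D.NonExpansive DN k := fun p q w hw =>
    hN.mem_d _ _ _ (hle hw) (hle (D.barWord_mem hw))
  have hkx : k x = a := hN.inj _ _ (by rw [hk, hd, hF.leftPolar_self, DN.d_self])
  have hky : k y = b := hN.inj _ _ (by rw [hk, D.d_self, hF.leftPolar_top, hN.d_eq])
  let s : Set N := {a, b}
  have hf : (DN.restrict s).NonExpansive D (fun p => if p.1 = a then x else y) := by
    have hab : DN.d a b ≤ D.d x y := (hN.d_eq.trans hd.symm).le
    have haab : ∀ p ∈ s, p ≠ a → p = b := fun p hp hpa => hp.resolve_left hpa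
    rintro ⟨p, hp⟩ ⟨q, hq⟩
    change DN.d p q ≤ D.d (if p = a then x else y) (if q = a then x else y)
    split_ifs with h₁ h₂ h₂
    · rw [D.d_self]; exact le_top
    · rw [h₁, haab q hq h₂]; exact hab
    · rw [h₂, haab p hp h₁]; exact d_le_of_d_le_symm hab
    · rw [D.d_self]; exact le_top
  obtain ⟨g, hg, hgs⟩ := hinj s N (DN.restrict s) DN _ Subtype.val hf fun _ _ => rfl
  have hga : g a = x := (congrFun hgs ⟨a, Or.inl rfl⟩).trans (if_pos rfl)
  have hgb : g b = y := by
    refine (congrFun hgs ⟨b, Or.inr rfl⟩).trans ?_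
    -- The case `a = b` occurs when `F = ⊤`; then `x = y` as well.
    by_cases hba : b = a
    · rw [if_pos hba, ← D.eq_top_iff, hd, ← hN.d_eq, DN.eq_top_iff, hba]
    · exact if_neg hba
  have hkg : ∀ p, k (g p) = p := hN.eq_of_nonExpansive (k ∘ g) (hkne.comp hg)
    (by simp [hga, hkx]) (by simp [hgb, hky])
  have hiso : DN.IsIsometry D g := fun p q => by
    refine le_antisymm ?_ (hg p q)
    have := hkne (g p) (g q)
    rwa [hkg, hkg] at this
  have hrange : Set.range g = Set.univ := by
    refine hmin _ ⟨a, hga⟩ ⟨b, hgb⟩ (hinj.restrict_of_retraction (hg.comp hkne)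
      (fun p => ⟨k p, rfl⟩) ?_)
    rintro _ ⟨p, rfl⟩
    simp [hkg]
  exact hN.of_isometry hiso (Set.range_eq_univ.1 hrange) hga hgb

end FMetric

end WordMetric

/-! ### Gluings, cut vertices and irreducibility -/

namespace WordMetric

namespace FMetric

variable {A : Type u} [PartialOrder A] {bar : A → A} {E : Type u} {D : FMetric bar E}

namespace IsGluing

variable {s t : Set E} {c : E}

theorem mem_left (h : D.IsGluing s t c) : c ∈ s := (h.2.1.ge rfl).1

theorem mem_right (h : D.IsGluing s t c) : c ∈ t := (h.2.1.ge rfl).2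

theorem eq_of_mem (h : D.IsGluing s t c) {p : E} (hs : p ∈ s) (ht : p ∈ t) : p = c :=
  h.2.1.le ⟨hs, ht⟩

theorem mem_right_of_notMem (h : D.IsGluing s t c) {p : E} (hp : p ∉ s) : p ∈ t :=
  (h.1.ge (Set.mem_univ p)).resolve_left hp

theorem symm (h : D.IsGluing s t c) : D.IsGluing t s c := by
  refine ⟨(Set.union_comm t s).trans h.1, (Set.inter_comm t s).trans h.2.1,
    fun p hp q hq => le_antisymm (fun w hw => ?_) (D.triangle p q c)⟩
  rw [← D.symm p q] at hw
  obtain ⟨v, hv, rfl⟩ := hw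
  rw [h.2.2 q hq p hp] at hv
  obtain ⟨a, ha, b, hb, rfl⟩ := Language.mem_mul.1 hv
  rw [barWord_append]
  exact Language.append_mem_mul (D.barWord_mem hb) (D.barWord_mem ha)

theorem mem_left_of_notMem (h : D.IsGluing s t c) {p : E} (hp : p ∉ t) : p ∈ s :=
  h.symm.mem_right_of_notMem hp

open Classical in
/-- Collapsing one part of a gluing to the common vertex is non-expansive. -/
theorem nonExpansive_collapse (h : D.IsGluing s t c) :
    D.NonExpansive D (fun p => if p ∈ s then p else c) := by
  have key : ∀ p ∈ s, ∀ q ∉ s, D.d p q ≤ D.d p c := fun p hp q hq => by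
    rw [h.2.2 p hp q (h.mem_right_of_notMem hq)]
    exact (D.isFinalSegment p c).mul_le_left
  intro p q
  dsimp only
  split_ifs with hp hq hq
  · exact le_rfl
  · exact key p hp q hq
  · exact d_le_of_d_le_symm (key q hq p hp)
  · rw [D.d_self]; exact le_top

theorem isInjective_left (h : D.IsGluing s t c) (hD : D.IsInjective) :
    (D.restrict s).IsInjective := by
  classical
  refine hD.restrict_of_retraction h.nonExpansive_collapse (fun p => ?_) fun p hp => if_pos hp
  split_ifs with hp
  exacts [hp, h.mem_left]

/-- No edge joins the two parts of a gluing outside the common vertex. -/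
theorem mem_right_of_adj (h : D.IsGluing s t c) {v w : E} (hvw : D.graph.Adj v w) (hv : v ≠ c)
    (hw : w ≠ c) (hvt : v ∈ t) : w ∈ t := by
  by_contra hwt
  obtain ⟨-, a, ha⟩ := hvw
  have ha' : [a] ∈ D.d v w := ha
  rw [h.symm.2.2 v hvt w (h.mem_left_of_notMem hwt)] at ha'
  obtain ⟨u, hu, k, hk, he⟩ := Language.mem_mul.1 ha'
  -- A single letter splits only with an empty factor, which identifies an endpoint with `c`.
  rcases List.append_eq_singleton_iff.1 he with ⟨rfl, -⟩ | ⟨-, rfl⟩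
  · exact hv (D.nil_mem_iff.1 hu)
  · exact hw (D.nil_mem_iff.1 hk).symm

end IsGluing

theorem _root_.SimpleGraph.Reachable.of_forall_adj {V : Type u} {K : SimpleGraph V} {Q : V → Prop}
    (hQ : ∀ v w, K.Adj v w → Q v → Q w) {v w : V} (h : K.Reachable v w) (hv : Q v) : Q w := by
  obtain ⟨p⟩ := h
  induction p with
  | nil => exact hv
  | cons hadj _ ih => exact ih (hQ _ _ hadj hv)

/-- A connected set of vertices without a cut vertex lies in one of the parts of a gluing. -/
theorem IsGluing.subset_or_subset {s t : Set E} {c : E} (h : D.IsGluing s t c) {B : Set E}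
    (hB : (D.graph.induce B).Connected) (hcut : ¬ ∃ v, IsCutVertex (D.graph.induce B) v) :
    B ⊆ s ∨ B ⊆ t := by
  by_contra! hc
  obtain ⟨⟨p, hpB, hps⟩, q, hqB, hqt⟩ := hc.imp Set.not_subset.1 Set.not_subset.1
  have hpc : p ≠ c := fun he => hps (he ▸ h.mem_left)
  have hqc : q ≠ c := fun he => hqt (he ▸ h.mem_right)
  have hreach := hB.preconnected ⟨p, hpB⟩ ⟨q, hqB⟩
  -- If `c ∈ B`, it is a cut vertex of `B`; otherwise `B` is already disconnected.
  by_cases hcB : c ∈ B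
  · refine hcut ⟨⟨c, hcB⟩, ⟨⟨p, hpB⟩, fun he => hpc (congrArg Subtype.val he)⟩,
      ⟨⟨q, hqB⟩, fun he => hqc (congrArg Subtype.val he)⟩, hreach, fun hr => hqt ?_⟩
    refine hr.of_forall_adj (Q := fun v : ({⟨c, hcB⟩}ᶜ : Set B) => (v.1 : E) ∈ t) (fun v w hvw => ?_)
      (h.mem_right_of_notMem hps)
    exact h.mem_right_of_adj hvw (fun he => v.2 (Subtype.ext he)) fun he => w.2 (Subtype.ext he)
  · refine hqt (hreach.of_forall_adj (Q := fun v : B => (v : E) ∈ t) (fun v w hvw => ?_)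
      (h.mem_right_of_notMem hps))
    exact h.mem_right_of_adj hvw (fun he => hcB (he ▸ v.2)) fun he => hcB (he ▸ w.2)

theorem graph_restrict (D : FMetric bar E) (C : Set E) :
    (D.restrict C).graph = D.graph.induce C := by
  ext p q
  exact and_congr_left fun _ => not_congr Subtype.ext_iff

namespace IsTight

variable {x y : E} {F G H : Language A}

/-- A factorization of `F` splits the tight space of `F` into a gluing. -/
theorem exists_isGluing (h : D.IsTight x y (G * H)) (hG : IsFinalSegment G)
    (hH : IsFinalSegment H) (hne : ∃ w, w ∈ G * H) :
    ∃ c, D.d x c = G ∧ D.d c y = H ∧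
      D.IsGluing {p | G ≤ D.d x p} {p | D.d x p ≤ G} c := by
  obtain ⟨w₀, hw₀⟩ := hne
  obtain ⟨hGne, hHne⟩ := exists_mem_of_exists_mem_mul hw₀
  obtain ⟨c, hc⟩ := h.surj H
  have hxc : D.d x c = G := hc.trans <| le_antisymm
    (fun u hu => hG.mem_of_forall_append_mem_mul_right hHne hu)
    fun u hu w hw => Language.append_mem_mul hu hw
  have hcy : D.d c y = H := by
    refine le_antisymm (fun w hw => ?_) fun w hw => h.mem_d_right fun u hu => ?_
    · exact hH.mem_of_forall_append_mem_mul_left hGne fun g hg => h.append_mem (hxc ▸ hg) hw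
    · exact Language.append_mem_mul (hxc ▸ hu) hw
  refine ⟨c, hxc, hcy, Set.eq_univ_of_forall fun p => ?_, ?_, fun p hp q hq => ?_⟩
  · by_contra hcon
    simp only [Set.mem_union, Set.mem_ofPred_eq, not_or] at hcon
    refine hcon.1 fun g hg => h.mem_of_forall fun w hw => Language.append_mem_mul hg ?_
    by_contra hwH
    exact hcon.2 fun u hu => (hG.mem_or_mem_of_append hH (h.append_mem hu hw)).resolve_right hwH
  · refine Set.eq_singleton_iff_unique_mem.2 ⟨⟨hxc.ge, hxc.le⟩, fun p hp => ?_⟩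
    exact h.inj p c ((le_antisymm hp.2 hp.1).trans hxc.symm)
  · refine le_antisymm (fun w hw => ?_) (D.triangle p q c)
    have hw' : ∀ u ∈ D.d x p, ∀ v ∈ D.d q y, u ++ w ++ v ∈ G * H := fun u hu v hv =>
      h.append_mem (D.append_mem hu hw) hv
    have hHQ : H ≤ D.d q y := fun v hv => h.mem_d_right fun u hu =>
      Language.append_mem_mul (hq hu) hv
    obtain ⟨r, t, rfl, hr, ht⟩ : ∃ r t, r ++ t = w ∧ (∀ u ∈ D.d x p, u ++ r ∈ G) ∧
        ∀ v ∈ D.d q y, t ++ v ∈ H := by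
      -- When `d(x, p) ⊆ G` the point `p` is `c` itself and the cut is at the start of `w`.
      by_cases hPG : D.d x p ≤ G
      · refine ⟨[], w, rfl, fun u hu => (List.append_nil u).symm ▸ hPG hu, fun v hv => ?_⟩
        refine hH.mem_of_forall_append_mem_mul_left hGne fun g hg => ?_
        rw [← List.append_assoc]
        exact hw' g (hp hg) v hv
      · exact hG.exists_split hH hHne hHQ w hPG hw'
    refine Language.append_mem_mul (h.mem_d _ _ _ (fun u hu => hxc ▸ hr u hu) fun u hu => ?_)
      (h.mem_d _ _ _ (fun u hu => h.mem_of_forall fun v hv => ?_) fun u hu => ?_)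
    · exact hp (hG.append_right _ (hxc ▸ hu))
    · rw [List.append_assoc]
      exact Language.append_mem_mul (hxc ▸ hu) (ht v hv)
    · rw [hxc]
      exact hG.append_right _ (hq hu)

theorem reachable_of_mem (h : D.IsTight x y F) {p q : E} {w : List A} (hw : w ∈ D.d p q) :
    D.graph.Reachable p q := by
  induction w generalizing p with
  | nil => exact D.nil_mem_iff.1 hw ▸ SimpleGraph.Reachable.refl _
  | cons a w ih =>
    obtain ⟨r, hr, hq⟩ := h.exists_between (u := [a]) hw
    by_cases hpr : p = r
    · exact hpr ▸ ih hq
    · exact (show D.graph.Adj p r from ⟨hpr, a, hr⟩).reachable.trans (ih hq)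

/-- For `f ∈ F`, the word `f ++ barWord bar f` is its own reversal and dominates `f`, so it lies in
every distance. -/
theorem connected (hb : Function.Involutive bar) (h : D.IsTight x y F) (hne : ∃ w, w ∈ F) :
    D.graph.Connected := by
  obtain ⟨f, hf⟩ := hne
  have key : ∀ (p : E) (u : List A), u ++ (f ++ barWord bar f) ∈ D.d x p := fun p u =>
    (D.isFinalSegment x p).of_sublist (by simp) (h.le_d p hf)
  have : Nonempty E := ⟨x⟩
  refine SimpleGraph.Connected.mk fun p q =>
    h.reachable_of_mem (w := f ++ barWord bar f) (h.mem_d _ _ _ (fun u _ => key q u) ?_)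
  rw [barWord_append, barWord_involutive hb]
  exact fun u _ => key p u

/-- A word in `d(p, q)` either splits at `c` or is read along a path avoiding `c`. -/
theorem mem_mul_or_reachable (h : D.IsTight x y F) {c p q : E} (hp : p ≠ c) (hq : q ≠ c)
    {w : List A} (hw : w ∈ D.d p q) :
    w ∈ D.d p c * D.d c q ∨ (D.graph.induce {c}ᶜ).Reachable ⟨p, hp⟩ ⟨q, hq⟩ := by
  induction w generalizing p with
  | nil =>
    obtain rfl := D.nil_mem_iff.1 hw
    exact Or.inr (SimpleGraph.Reachable.refl _)
  | cons a w ih =>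
    obtain ⟨r, hr, hrq⟩ := h.exists_between (u := [a]) hw
    by_cases hrc : r = c
    · subst hrc
      exact Or.inl (Language.append_mem_mul (a := [a]) hr hrq)
    rcases ih hrc hrq with hm | hreach
    · obtain ⟨u, hu, v, hv, rfl⟩ := Language.mem_mul.1 hm
      exact Or.inl (Language.append_mem_mul (a := a :: u) (D.append_mem (u := [a]) hr hu) hv)
    · refine Or.inr ?_
      by_cases hpr : p = r
      · subst hpr
        exact hreach
      · refine (SimpleGraph.Adj.reachable ?_).trans hreach
        exact ⟨hpr, a, hr⟩

/-- One part is a component of the graph without `c`, the other is the rest, and `c` is added to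
both. A word from one to the other cannot be read while avoiding `c`. -/
theorem exists_isGluing_of_isCutVertex (h : D.IsTight x y F) {c : E}
    (hc : IsCutVertex D.graph c) :
    ∃ s t : Set E, s ≠ Set.univ ∧ t ≠ Set.univ ∧ D.IsGluing s t c := by
  obtain ⟨⟨v, hv⟩, ⟨w, hw⟩, -, hvw⟩ := hc
  let R : E → Prop := fun p => ∃ hp : p ≠ c, (D.graph.induce {c}ᶜ).Reachable ⟨v, hv⟩ ⟨p, hp⟩
  refine ⟨{p | p = c ∨ R p}, {p | p = c ∨ ¬ R p}, ?_, ?_, ?_, ?_, ?_⟩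
  · intro hs
    rcases hs.ge (Set.mem_univ w) with h₁ | ⟨_, h₁⟩
    exacts [hw h₁, hvw h₁]
  · intro ht
    rcases ht.ge (Set.mem_univ v) with h₁ | h₁
    exacts [hv h₁, h₁ ⟨hv, SimpleGraph.Reachable.refl _⟩]
  · refine Set.eq_univ_of_forall fun p => ?_
    by_cases hp : R p
    exacts [Or.inl (Or.inr hp), Or.inr (Or.inr hp)]
  · ext p
    simp only [Set.mem_inter_iff, Set.mem_ofPred_eq, Set.mem_singleton_iff]
    tauto
  · intro p hp q hq
    refine le_antisymm ?_ (D.triangle p q c)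
    by_cases hpc : p = c
    · subst hpc
      rw [D.d_self, (D.isFinalSegment p q).top_mul]
    by_cases hqc : q = c
    · subst hqc
      rw [D.d_self, (D.isFinalSegment p q).mul_top]
    obtain ⟨_, hvp⟩ := hp.resolve_left hpc
    intro u hu
    refine (h.mem_mul_or_reachable hpc hqc hu).resolve_right fun hr => ?_
    exact hq.resolve_left hqc ⟨hqc, hvp.trans hr⟩

theorem not_isCutVertex_of_isIrreducible (h : D.IsTight x y F) (hD : D.IsIrreducible) :
    ¬ ∃ c, IsCutVertex D.graph c := by
  rintro ⟨c, hc⟩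
  obtain ⟨s, t, hs, ht, hg⟩ := h.exists_isGluing_of_isCutVertex hc
  exact hD.2 ⟨s, t, c, hs, ht, hg.isInjective_left h.isInjective,
    hg.symm.isInjective_left h.isInjective, hg⟩

theorem isIrreducible_of_isIrreducibleSegment (h : D.IsTight x y F)
    (hF : IsIrreducibleSegment F) : D.IsIrreducible := by
  refine ⟨h.isInjective, ?_⟩
  -- By minimality neither proper part contains both `x` and `y`; with `x ∈ s` this makes `F = d(x,
  -- c) d(c, y)` a forbidden factorization. Exchanging the parts puts `x` in neither.
  have key : ∀ (s t : Set E) (c : E), s ≠ Set.univ → t ≠ Set.univ →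
      (D.restrict s).IsInjective → (D.restrict t).IsInjective → D.IsGluing s t c → x ∉ s := by
    intro s t c hs ht hsi hti hg hxs
    have hys : y ∉ s := fun hys => hs (h.isInjectiveEnvelope.2.2 s hxs hys hsi)
    have hxt : x ∉ t := fun hxt =>
      ht (h.isInjectiveEnvelope.2.2 t hxt (hg.mem_right_of_notMem hys) hti)
    refine hF.2.2 ⟨D.d x c, D.d c y, D.isFinalSegment _ _, D.isFinalSegment _ _, fun he => ?_,
      fun he => ?_, ?_⟩
    · exact hys (h.inj c y (he.trans h.d_eq.symm) ▸ hg.mem_left)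
    · exact hxt (h.inj_right (he.trans h.d_eq.symm) ▸ hg.mem_right)
    · rw [← hg.2.2 x hxs y (hg.mem_right_of_notMem hys), h.d_eq]
  rintro ⟨s, t, c, hs, ht, hsi, hti, hg⟩
  exact key t s c ht hs hti hsi hg.symm (hg.mem_right_of_notMem (key s t c hs ht hsi hti hg))

theorem exists_isCutVertex (h : D.IsTight x y F) (hne : F ≠ ⊤)
    (hF : ¬ IsIrreducibleSegment F) : ∃ c, IsCutVertex D.graph c := by
  have hFs := h.isFinalSegment
  obtain ⟨w, hw⟩ := exists_mem_of_not_irreducible hFs hne hF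
  obtain ⟨G, H, hG, hH, hGF, hHF, -, -, rfl⟩ := exists_mul_eq_of_not_irreducible hFs hne hF
  obtain ⟨c, hxc, hcy, hg⟩ := h.exists_isGluing hG hH ⟨w, hw⟩
  have hx : x ≠ c := by
    rintro rfl
    exact hHF (hcy.symm.trans h.d_eq)
  have hy : y ≠ c := by
    rintro rfl
    exact hGF (hxc.symm.trans h.d_eq)
  have hyt : y ∈ {p | D.d x p ≤ G} := h.d_eq.trans_le hG.mul_le_left
  have hxs : x ∈ {p | G ≤ D.d x p} := (le_top : G ≤ ⊤).trans_eq (D.d_self x).symm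
  refine ⟨c, ⟨x, hx⟩, ⟨y, hy⟩, h.reachable_of_mem (h.d_eq.symm ▸ hw), fun hr => ?_⟩
  refine hy (hg.eq_of_mem ?_ hyt)
  refine hr.of_forall_adj (Q := fun v : ({c}ᶜ : Set E) => (v : E) ∈ {p | G ≤ D.d x p}) (fun v w hvw => ?_) hxs
  exact hg.symm.mem_right_of_adj hvw v.2 w.2

/-- The part of a tight space between two gluing vertices is tight. -/
theorem restrict_inter (hb : Function.Involutive bar) (hm : Monotone bar) (h : D.IsTight x y F)
    {s₁ t₁ s₂ t₂ : Set E} {c₁ c₂ : E} (h₁ : D.IsGluing s₁ t₁ c₁) (h₂ : D.IsGluing s₂ t₂ c₂)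
    (hs : s₁ ⊆ s₂) (ht : t₂ ⊆ t₁) (hx : x ∈ s₁) (hy : y ∈ t₂) :
    (D.restrict (t₁ ∩ s₂)).IsTight ⟨c₁, h₁.mem_right, hs h₁.mem_left⟩
      ⟨c₂, ht h₂.mem_right, h₂.mem_left⟩ (D.d c₁ c₂) := by
  classical
  have hinj : (D.restrict (t₁ ∩ s₂)).IsInjective := by
    refine h.isInjective.restrict_of_retraction
      (h₂.nonExpansive_collapse.comp h₁.symm.nonExpansive_collapse) (fun p => ?_) fun p hp => ?_
    · have hp : (if p ∈ t₁ then p else c₁) ∈ t₁ := by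
        split_ifs with hp
        exacts [hp, h₁.mem_right]
      have key : ∀ q ∈ t₁, (if q ∈ s₂ then q else c₂) ∈ t₁ ∩ s₂ := fun q hq => by
        split_ifs with hqs
        exacts [⟨hq, hqs⟩, ⟨ht h₂.mem_right, h₂.mem_left⟩]
      exact key _ hp
    · simp [hp.1, hp.2]
  refine (hinj.isInjectiveEnvelope fun f hf hf₁ hf₂ => ?_).isTight hb hm
  -- Extending `f` by the identity stays non-expansive, because words leaving the middle piece pass
  -- through `c₁` or `c₂`, both fixed by `f`. Rigidity of the whole space then gives `f = id`.
  let g : E → E := fun p => if hp : p ∈ t₁ ∩ s₂ then f ⟨p, hp⟩ else p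
  have hgC : ∀ p (hp : p ∈ t₁ ∩ s₂), g p = f ⟨p, hp⟩ := fun p hp => dif_pos hp
  have hgN : ∀ p ∉ t₁ ∩ s₂, g p = p := fun p hp => dif_neg hp
  have hg₁ : ∀ p ∈ s₁, g p = p := by
    intro p hp
    by_cases hpC : p ∈ t₁ ∩ s₂
    · obtain rfl := h₁.eq_of_mem hp hpC.1
      rw [hgC p hpC, hf₁]
    · exact hgN p hpC
  have hg₂ : ∀ p ∈ t₂, g p = p := by
    intro p hp
    by_cases hpC : p ∈ t₁ ∩ s₂
    · obtain rfl := h₂.eq_of_mem hpC.2 hp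
      rw [hgC p hpC, hf₂]
    · exact hgN p hpC
  have key : ∀ p ∈ t₁ ∩ s₂, ∀ q ∉ t₁ ∩ s₂, D.d p q ≤ D.d (g p) (g q) := by
    intro p hp q hq w hw
    rw [hgN q hq, hgC p hp]
    by_cases hqt : q ∈ t₁
    · have hq₂ : q ∈ t₂ := h₂.mem_right_of_notMem fun hqs => hq ⟨hqt, hqs⟩
      rw [h₂.2.2 p hp.2 q hq₂] at hw
      obtain ⟨u, hu, v, hv, rfl⟩ := Language.mem_mul.1 hw
      refine D.append_mem ?_ hv
      have := hf ⟨p, hp⟩ ⟨c₂, ht h₂.mem_right, h₂.mem_left⟩ hu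
      rwa [hf₂] at this
    · rw [h₁.symm.2.2 p hp.1 q (h₁.mem_left_of_notMem hqt)] at hw
      obtain ⟨u, hu, v, hv, rfl⟩ := Language.mem_mul.1 hw
      refine D.append_mem ?_ hv
      have := hf ⟨p, hp⟩ ⟨c₁, h₁.mem_right, hs h₁.mem_left⟩ hu
      rwa [hf₁] at this
  have hg : D.NonExpansive D g := by
    intro p q
    by_cases hp : p ∈ t₁ ∩ s₂ <;> by_cases hq : q ∈ t₁ ∩ s₂
    · rw [hgC p hp, hgC q hq]
      exact hf ⟨p, hp⟩ ⟨q, hq⟩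
    · exact key p hp q hq
    · exact d_le_of_d_le_symm (key q hq p hp)
    · rw [hgN p hp, hgN q hq]
  rintro ⟨p, hp⟩
  refine Subtype.ext ?_
  rw [← hgC p hp]
  exact h.eq_of_nonExpansive g hg (hg₁ x hx) (hg₂ y hy) p

end IsTight

end FMetric

end WordMetric

/-! ### Irreducible factorizations and blocks -/

namespace WordMetric

section Factorization

variable {A : Type u}

/-- The product of the first `i` factors, as a final segment. -/
def prefixProd (L : List (Language A)) (i : ℕ) : Language A := ⊤ * (L.take i).prod

/-- The product of all but the first `i` factors, as a final segment. -/
def suffixProd (L : List (Language A)) (i : ℕ) : Language A := (L.drop i).prod * ⊤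

theorem prefixProd_succ {L : List (Language A)} {i : ℕ} (hi : i < L.length) :
    prefixProd L (i + 1) = prefixProd L i * L[i] := by
  rw [prefixProd, prefixProd, List.prod_take_succ _ _ hi, mul_assoc]

/-- The leading `⊤` absorbs the empty product `{[]}`, which in general is not a final segment. -/
theorem prefixProd_zero (L : List (Language A)) : prefixProd L 0 = ⊤ := by
  simp [prefixProd]

variable [PartialOrder A] {L : List (Language A)}

theorem IsFinalSegment.mul_list_prod {K : Language A} (hK : IsFinalSegment K)
    (hL : ∀ G ∈ L, IsFinalSegment G) : IsFinalSegment (K * L.prod) := by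
  induction L generalizing K with
  | nil => simpa using hK
  | cons G L ih =>
    rw [List.prod_cons, ← mul_assoc]
    exact ih (hK.mul (hL G List.mem_cons_self)) fun M hM => hL M (List.mem_cons_of_mem _ hM)

theorem IsFinalSegment.list_prod_mul {K : Language A} (hK : IsFinalSegment K)
    (hL : ∀ G ∈ L, IsFinalSegment G) : IsFinalSegment (L.prod * K) := by
  induction L with
  | nil => simpa using hK
  | cons G L ih =>
    rw [List.prod_cons, mul_assoc]
    exact (hL G List.mem_cons_self).mul (ih fun M hM => hL M (List.mem_cons_of_mem _ hM))

theorem isFinalSegment_prefixProd (hL : ∀ G ∈ L, IsFinalSegment G) (i : ℕ) :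
    IsFinalSegment (prefixProd L i) :=
  IsFinalSegment.top.mul_list_prod fun G hG => hL G (List.mem_of_mem_take hG)

theorem isFinalSegment_suffixProd (hL : ∀ G ∈ L, IsFinalSegment G) (i : ℕ) :
    IsFinalSegment (suffixProd L i) :=
  IsFinalSegment.top.list_prod_mul fun G hG => hL G (List.mem_of_mem_drop hG)

theorem prefixProd_length (hF : IsFinalSegment L.prod) : prefixProd L L.length = L.prod := by
  rw [prefixProd, List.take_length, hF.top_mul]

theorem prefixProd_mul_suffixProd (hF : IsFinalSegment L.prod) (i : ℕ) :
    prefixProd L i * suffixProd L i = L.prod := by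
  rw [prefixProd, suffixProd, mul_assoc, ← mul_assoc (L.take i).prod, List.prod_take_mul_prod_drop,
    hF.mul_top, hF.top_mul]

theorem prefixProd_antitone (hL : ∀ G ∈ L, IsFinalSegment G) : Antitone (prefixProd L) := by
  refine antitone_nat_of_succ_le fun i => ?_
  by_cases hi : i < L.length
  · rw [prefixProd_succ hi]
    exact (isFinalSegment_prefixProd hL i).mul_le_left
  · rw [prefixProd, prefixProd, List.take_of_length_le (by omega),
      List.take_of_length_le (by omega)]

end Factorization

namespace FMetric

variable {A : Type u} [PartialOrder A] {bar : A → A} {E : Type u} {D : FMetric bar E}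

/-- The points of a space lying between two consecutive products of factors. -/
def factorBlock (D : FMetric bar E) (x : E) (L : List (Language A)) (i : ℕ) : Set E :=
  {p | D.d x p ≤ prefixProd L i} ∩ {p | prefixProd L (i + 1) ≤ D.d x p}

namespace IsTight

variable {x y : E} {L : List (Language A)}

theorem exists_cut_points (h : D.IsTight x y L.prod) (hL : ∀ G ∈ L, IsFinalSegment G)
    (hne : ∃ w, w ∈ L.prod) :
    ∃ c : ℕ → E, ∀ i, D.d x (c i) = prefixProd L i ∧
      D.IsGluing {p | prefixProd L i ≤ D.d x p} {p | D.d x p ≤ prefixProd L i} (c i) := by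
  have key : ∀ i, ∃ c, D.d x c = prefixProd L i ∧
      D.IsGluing {p | prefixProd L i ≤ D.d x p} {p | D.d x p ≤ prefixProd L i} c := by
    intro i
    have he := prefixProd_mul_suffixProd h.isFinalSegment i
    rw [← he] at hne
    obtain ⟨c, hc, -, hg⟩ := exists_isGluing (he.symm ▸ h) (isFinalSegment_prefixProd hL i)
      (isFinalSegment_suffixProd hL i) hne
    exact ⟨c, hc, hg⟩
  choose c hc using key
  exact ⟨c, hc⟩

variable {c : ℕ → E}

theorem cut_point_zero (h : D.IsTight x y L.prod) (hc : ∀ i, D.d x (c i) = prefixProd L i) :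
    c 0 = x :=
  h.inj _ _ (by rw [hc, prefixProd_zero, D.d_self])

theorem cut_point_length (h : D.IsTight x y L.prod) (hc : ∀ i, D.d x (c i) = prefixProd L i) :
    c L.length = y :=
  h.inj _ _ (by rw [hc, prefixProd_length h.isFinalSegment, h.d_eq])

theorem left_mem_factorBlock (hL : ∀ G ∈ L, IsFinalSegment G)
    (hc : ∀ i, D.d x (c i) = prefixProd L i) (i : ℕ) : c i ∈ D.factorBlock x L i :=
  ⟨(hc i).le, (prefixProd_antitone hL i.le_succ).trans (hc i).ge⟩

theorem right_mem_factorBlock (hL : ∀ G ∈ L, IsFinalSegment G)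
    (hc : ∀ i, D.d x (c i) = prefixProd L i) (i : ℕ) : c (i + 1) ∈ D.factorBlock x L i :=
  ⟨(hc (i + 1)).trans_le (prefixProd_antitone hL i.le_succ), (hc (i + 1)).ge⟩

/-- Since `x` and `c (i + 1)` lie on opposite sides of the gluing at `c i`, the distance between the
cut points is what remains after cancelling the prefix. -/
theorem d_cut_points (h : D.IsTight x y L.prod) (hL : ∀ G ∈ L, IsFinalSegment G)
    (hne : ∃ w, w ∈ L.prod) (hc : ∀ i, D.d x (c i) = prefixProd L i ∧
      D.IsGluing {p | prefixProd L i ≤ D.d x p} {p | D.d x p ≤ prefixProd L i} (c i))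
    {i : ℕ} (hi : i < L.length) : D.d (c i) (c (i + 1)) = L[i] := by
  obtain ⟨w, hw⟩ := hne
  refine (hL _ (List.getElem_mem hi)).mul_left_cancel (D.isFinalSegment _ _)
    (G := prefixProd L i) ⟨w, (hc i).1 ▸ h.le_d _ hw⟩ ?_
  have := (hc i).2.2.2 x (by simp [D.d_self]) (c (i + 1))
    ((hc (i + 1)).1.trans_le (prefixProd_antitone hL i.le_succ))
  rw [(hc _).1, (hc _).1] at this
  rw [← this, prefixProd_succ hi]

theorem restrict_factorBlock (hb : Function.Involutive bar) (hm : Monotone bar)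
    (h : D.IsTight x y L.prod) (hL : ∀ G ∈ L, IsFinalSegment G)
    (hne : ∃ w, w ∈ L.prod) (hc : ∀ i, D.d x (c i) = prefixProd L i ∧
      D.IsGluing {p | prefixProd L i ≤ D.d x p} {p | D.d x p ≤ prefixProd L i} (c i))
    {i : ℕ} (hi : i < L.length) :
    (D.restrict (D.factorBlock x L i)).IsTight
      ⟨c i, left_mem_factorBlock hL (fun i => (hc i).1) i⟩
      ⟨c (i + 1), right_mem_factorBlock hL (fun i => (hc i).1) i⟩ L[i] := by
  have hanti := prefixProd_antitone hL
  have := h.restrict_inter hb hm (hc i).2 (hc (i + 1)).2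
    (fun p hp => (hanti i.le_succ).trans hp) (fun p hp => le_trans hp (hanti i.le_succ))
    (by simp [D.d_self]) ?_
  · rwa [h.d_cut_points hL hne hc hi] at this
  · refine h.d_eq.trans_le ?_
    rw [← prefixProd_length h.isFinalSegment]
    exact hanti hi

/-- Equal consecutive prefixes would merge two cut points and make an irreducible factor equal to
`⊤`. -/
theorem prefixProd_ne_succ (h : D.IsTight x y L.prod) (hL : ∀ G ∈ L, IsIrreducibleSegment G)
    (hne : ∃ w, w ∈ L.prod) {i : ℕ} (hi : i < L.length) :
    ¬ prefixProd L i ≤ prefixProd L (i + 1) := by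
  intro hle
  have hLf : ∀ G ∈ L, IsFinalSegment G := fun G hG => (hL G hG).1
  obtain ⟨c, hc⟩ := h.exists_cut_points hLf hne
  have : c i = c (i + 1) := h.inj _ _ (by
    rw [(hc _).1, (hc _).1]
    exact le_antisymm hle (prefixProd_antitone hLf i.le_succ))
  refine (hL _ (List.getElem_mem hi)).2.1 ?_
  rw [← h.d_cut_points hLf hne hc hi, D.eq_top_iff, this]

theorem factorBlock_inter_eq_empty (h : D.IsTight x y L.prod)
    (hL : ∀ G ∈ L, IsIrreducibleSegment G) (hne : ∃ w, w ∈ L.prod) {i j : ℕ} (hij : i + 1 < j)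
    (hj : j < L.length) : D.factorBlock x L i ∩ D.factorBlock x L j = ∅ := by
  have hLf : ∀ G ∈ L, IsFinalSegment G := fun G hG => (hL G hG).1
  refine Set.eq_empty_of_forall_notMem fun p hp => ?_
  exact h.prefixProd_ne_succ hL hne (i := i + 1) (by omega)
    ((hp.1.2.trans hp.2.1).trans (prefixProd_antitone hLf hij))

theorem factorBlock_inter_succ (hL : ∀ G ∈ L, IsFinalSegment G)
    (hc : ∀ i, D.d x (c i) = prefixProd L i ∧
      D.IsGluing {p | prefixProd L i ≤ D.d x p} {p | D.d x p ≤ prefixProd L i} (c i)) (i : ℕ) :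
    D.factorBlock x L i ∩ D.factorBlock x L (i + 1) = {c (i + 1)} := by
  refine Set.eq_singleton_iff_unique_mem.2 ⟨⟨right_mem_factorBlock hL (fun i => (hc i).1) i,
    left_mem_factorBlock hL (fun i => (hc i).1) (i + 1)⟩, fun p hp => ?_⟩
  exact (hc (i + 1)).2.eq_of_mem hp.1.2 hp.2.1

theorem eq_of_factorBlock_subset (h : D.IsTight x y L.prod)
    (hL : ∀ G ∈ L, IsIrreducibleSegment G) (hne : ∃ w, w ∈ L.prod) {i j : ℕ} (hi : i < L.length)
    (hij : D.factorBlock x L i ⊆ D.factorBlock x L j) : i = j := by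
  have hLf : ∀ G ∈ L, IsFinalSegment G := fun G hG => (hL G hG).1
  obtain ⟨c, hc⟩ := h.exists_cut_points hLf hne
  have hc' := fun i => (hc i).1
  have hanti := prefixProd_antitone hLf
  rcases lt_trichotomy i j with hlt | heq | hlt
  · have := (hij (left_mem_factorBlock hLf hc' i)).1
    rw [Set.mem_ofPred_eq, hc'] at this
    exact absurd (this.trans (hanti hlt)) (h.prefixProd_ne_succ hL hne hi)
  · exact heq
  · have := (hij (right_mem_factorBlock hLf hc' i)).2
    rw [Set.mem_ofPred_eq, hc'] at this
    exact absurd ((hanti hlt).trans this) (h.prefixProd_ne_succ hL hne hi)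

theorem exists_subset_factorBlock (h : D.IsTight x y L.prod) (hL : ∀ G ∈ L, IsFinalSegment G)
    (hne : ∃ w, w ∈ L.prod) (hpos : 0 < L.length) {B : Set E}
    (hB : (D.graph.induce B).Connected) (hcut : ¬ ∃ v, IsCutVertex (D.graph.induce B) v) :
    ∃ i < L.length, B ⊆ D.factorBlock x L i := by
  classical
  obtain ⟨c, hc⟩ := h.exists_cut_points hL hne
  -- Choose the least `i` with `B` on the `x`-side of the cut point `i + 1`; the last one, `y`,
  -- always qualifies. By minimality `B` is then on the `y`-side of the cut point `i`.
  have hex : ∃ i, B ⊆ {p | prefixProd L (i + 1) ≤ D.d x p} := ⟨L.length - 1, fun p _ => by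
    rw [Set.mem_ofPred_eq, Nat.sub_add_cancel hpos, prefixProd_length h.isFinalSegment]
    exact h.le_d p⟩
  refine ⟨Nat.find hex, ?_, Set.subset_inter ?_ (Nat.find_spec hex)⟩
  · refine (Nat.find_min' hex (m := L.length - 1) fun p _ => ?_).trans_lt (by omega)
    rw [Set.mem_ofPred_eq, Nat.sub_add_cancel hpos, prefixProd_length h.isFinalSegment]
    exact h.le_d p
  · rcases hn : Nat.find hex with _ | n
    · intro p _
      rw [Set.mem_ofPred_eq, prefixProd_zero]
      exact le_top
    · exact ((hc (n + 1)).2.subset_or_subset hB hcut).resolve_left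
        (Nat.find_min hex (m := n) (by omega))

/-- The blocks of the graph of a tight space are the subspaces of the irreducible factors. -/
theorem isBlock_iff (hb : Function.Involutive bar) (hm : Monotone bar)
    (h : D.IsTight x y L.prod) (hL : ∀ G ∈ L, IsIrreducibleSegment G)
    (hne : ∃ w, w ∈ L.prod) (hpos : 0 < L.length) {B : Set E} :
    IsBlock D.graph B ↔ ∃ i < L.length, D.factorBlock x L i = B := by
  have hLf : ∀ G ∈ L, IsFinalSegment G := fun G hG => (hL G hG).1
  obtain ⟨c, hc⟩ := h.exists_cut_points hLf hne
  have hblock : ∀ i < L.length, (D.graph.induce (D.factorBlock x L i)).Connected ∧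
      ¬ ∃ v, IsCutVertex (D.graph.induce (D.factorBlock x L i)) v := by
    intro i hi
    have ht := h.restrict_factorBlock hb hm hLf hne hc hi
    have hirr := hL _ (List.getElem_mem hi)
    rw [← graph_restrict]
    refine ⟨ht.connected hb ?_,
      ht.not_isCutVertex_of_isIrreducible (ht.isIrreducible_of_isIrreducibleSegment hirr)⟩
    -- Connectedness needs a nonempty factor, and factors of a nonempty product are nonempty.
    obtain ⟨w, hw⟩ := hne
    have hw' : w ∈ prefixProd L (i + 1) := (hc (i + 1)).1 ▸ h.le_d _ hw
    rw [prefixProd_succ hi] at hw'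
    exact (exists_mem_of_exists_mem_mul hw').2
  constructor
  · intro hB
    obtain ⟨i, hi, hBi⟩ := h.exists_subset_factorBlock hLf hne hpos hB.1.1 hB.1.2
    exact ⟨i, hi, (hB.2 (hblock i hi) hBi).antisymm hBi⟩
  · rintro ⟨i, hi, rfl⟩
    refine ⟨hblock i hi, fun B hB hiB => ?_⟩
    obtain ⟨j, hj, hBj⟩ := h.exists_subset_factorBlock hLf hne hpos hB.1 hB.2
    obtain rfl := h.eq_of_factorBlock_subset hL hne hi (hiB.trans hBj)
    exact hBj

end IsTight

theorem IsIsometry.automataIso {E' : Type u} {D' : FMetric bar E'} {e : E ≃ E'}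
    (he : D.IsIsometry D' e) (x y : E) :
    AutomataIso (D.transitionSystem.automaton x y)
      (D'.transitionSystem.automaton (e x) (e y)) := by
  refine ⟨e, fun p a q => ?_, fun p => e.injective.eq_iff.symm, fun p => e.injective.eq_iff.symm⟩
  change [a] ∈ D.d p q ↔ [a] ∈ D'.d (e p) (e q)
  rw [he]

end FMetric

end WordMetric

theorem mainTheorem5 {A : Type u} [PartialOrder A] (bar : A → A)
    (bar_involutive : Function.Involutive bar) (bar_monotone : Monotone bar)
    (F : Language A) (hF : WordMetric.IsFinalSegment F) (hF_ne : F ≠ ⊤) :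
    (∃ (S : Type u) (D : WordMetric.FMetric bar S) (x y : S), D.IsInjectiveEnvelope x y F) ∧
    ∀ (S : Type u) (D : WordMetric.FMetric bar S) (x y : S), D.IsInjectiveEnvelope x y F →
      (D.transitionSystem.automaton x y).accepts = F ∧
      (WordMetric.IsIrreducibleSegment F ↔ D.IsIrreducible) ∧
      (D.IsIrreducible ↔ ¬ ∃ c, WordMetric.IsCutVertex D.graph c) ∧
      (¬ WordMetric.IsIrreducibleSegment F →
        ∃ (m : ℕ) (C : Fin (m + 2) → Set S) (a b : (i : Fin (m + 2)) → C i)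
          (Fs : Fin (m + 2) → Language A),
          -- the blocks are exactly the `C i`, without repetition, and they form a path
          Function.Injective C ∧
          Set.range C = {B | WordMetric.IsBlock D.graph B} ∧
          (∀ i j : Fin (m + 2), i.val + 1 < j.val → C i ∩ C j = ∅) ∧
          (∀ i : Fin (m + 1),
            C i.castSucc ∩ C i.succ = {(b i.castSucc : S)} ∧
            C i.castSucc ∩ C i.succ = {(a i.succ : S)}) ∧
          x ∈ C 0 ∧ y ∈ C (Fin.last (m + 1)) ∧
          (a 0 : S) = x ∧ (b (Fin.last (m + 1)) : S) = y ∧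
          -- the corresponding factorization of `F`
          (∀ i, WordMetric.IsFinalSegment (Fs i)) ∧
          F = (List.ofFn Fs).prod ∧
          ∀ i,
            ((D.transitionSystem.restrict (C i)).automaton (a i) (b i)).accepts = Fs i ∧
            (∃ (T : Type u) (D' : WordMetric.FMetric bar T) (x' y' : T),
              D'.IsInjectiveEnvelope x' y' (Fs i)) ∧
            ∀ (T : Type u) (D' : WordMetric.FMetric bar T) (x' y' : T),
              D'.IsInjectiveEnvelope x' y' (Fs i) →
              WordMetric.AutomataIso (D'.transitionSystem.automaton x' y')
                ((D.transitionSystem.restrict (C i)).automaton (a i) (b i))) := by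
  obtain ⟨S₀, D₀, x₀, y₀, h₀⟩ := WordMetric.FMetric.exists_isTight bar_involutive bar_monotone hF
  refine ⟨⟨S₀, D₀, x₀, y₀, h₀.isInjectiveEnvelope⟩, fun S D x y hS => ?_⟩
  have h := hS.isTight bar_involutive bar_monotone
  -- Three implications in a cycle: irreducible segment, irreducible space, no cut vertex.
  have hsegment : WordMetric.IsIrreducibleSegment F → D.IsIrreducible :=
    h.isIrreducible_of_isIrreducibleSegment
  have hcut : (¬ ∃ c, WordMetric.IsCutVertex D.graph c) → WordMetric.IsIrreducibleSegment F :=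
    fun hc => by_contra fun hirr => hc (h.exists_isCutVertex hF_ne hirr)
  have hspace : D.IsIrreducible → ¬ ∃ c, WordMetric.IsCutVertex D.graph c :=
    h.not_isCutVertex_of_isIrreducible
  refine ⟨(h.accepts_eq x y).trans h.d_eq, ⟨hsegment, hcut ∘ hspace⟩,
    ⟨hspace, hsegment ∘ hcut⟩, fun hirr => ?_⟩
  obtain ⟨w, hw⟩ := WordMetric.exists_mem_of_not_irreducible hF hF_ne hirr
  obtain ⟨L, hLne, hL, rfl⟩ := WordMetric.exists_irreducible_factorization w hF hF_ne hw
  have hLf : ∀ G ∈ L, WordMetric.IsFinalSegment G := fun G hG => (hL G hG).1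
  -- A single factor would make `F` irreducible, so there are at least two.
  obtain ⟨m, hlen⟩ : ∃ m, L.length = m + 2 := by
    rcases L with _ | ⟨G, _ | ⟨H, L⟩⟩
    · exact absurd rfl hLne
    · exact absurd (by simpa using hL) hirr
    · exact ⟨L.length, rfl⟩
  have hlt : ∀ i : Fin (m + 2), i.val < L.length := fun i => i.2.trans_eq hlen.symm
  obtain ⟨c, hc⟩ := h.exists_cut_points hLf ⟨w, hw⟩
  have hc' := fun i => (hc i).1
  have hzero := h.cut_point_zero hc'
  have hlast := h.cut_point_length hc'
  rw [hlen] at hlast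
  have hleft := fun i => WordMetric.FMetric.IsTight.left_mem_factorBlock hLf hc' i
  have hright := fun i => WordMetric.FMetric.IsTight.right_mem_factorBlock hLf hc' i
  have htight := fun i : Fin (m + 2) =>
    h.restrict_factorBlock bar_involutive bar_monotone hLf ⟨w, hw⟩ hc (hlt i)
  refine ⟨m, fun i => D.factorBlock x L i, fun i => ⟨c i, hleft i⟩, fun i => ⟨c (i + 1), hright i⟩,
    fun i => L[i.val]'(hlt i), fun i j hij => ?_, ?_, fun i j hij => ?_, fun i => ?_,
    hzero ▸ hleft 0, hlast ▸ hright (m + 1), hzero, hlast,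
    fun i => hLf _ (List.getElem_mem _), ?_, fun i => ⟨?_, ?_, fun T D' x' y' hT => ?_⟩⟩
  · exact Fin.ext (h.eq_of_factorBlock_subset hL ⟨w, hw⟩ (hlt i) hij.le)
  · ext B
    refine Iff.trans ?_
      (h.isBlock_iff bar_involutive bar_monotone hL ⟨w, hw⟩ (by omega) (B := B)).symm
    constructor
    · rintro ⟨i, rfl⟩
      exact ⟨i, hlt i, rfl⟩
    · rintro ⟨i, hi, rfl⟩
      exact ⟨⟨i, hi.trans_eq hlen⟩, rfl⟩
  · exact h.factorBlock_inter_eq_empty hL ⟨w, hw⟩ hij (hlt j)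
  · have := WordMetric.FMetric.IsTight.factorBlock_inter_succ hLf hc i
    exact ⟨this, this⟩
  · congr 1
    refine List.ext_getElem (by simp [hlen]) fun i _ _ => by rw [List.getElem_ofFn]
  · exact ((htight i).accepts_eq _ _).trans (htight i).d_eq
  · exact ⟨_, _, _, _, (htight i).isInjectiveEnvelope⟩
  · obtain ⟨e, hx, hy, he⟩ :=
      (hT.isTight bar_involutive bar_monotone).exists_isometry (htight i)
    have := he.automataIso x' y'
    rwa [hx, hy] at this
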